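/- **Definitions.** For $a,b$ in a partially ordered set $S$ write $a\ll b$ if for every increasing sequence $(b_n)_n$ in $S$ that has a supremum with $b\le\sup_n b_n$ there is $N$ with $a\le b_N$. A *$\mathrm{Cu}$-semigroup* is a commutative monoid $S$ with a translation-invariant partial order such that $0\le a$ for all $a\in S$, and such that: (O1) increasing sequences have suprema; (O2) every element is the supremum of a $\ll$-increasing sequence; (O3) $a'\ll a$ and $b'\ll b$ imply $a'+b'\ll a+b$; (O4) $\sup_n(a_n+b_n)=\sup_na_n+\sup_nb_n$ for increasing sequences $(a_n)_n,(b_n)_n$. - (O5): if $a+b\le c$, $a'\ll a$ and $b'\ll b$, then there is $x\in S$ with $a'+x\le c\le a+x$ and $b'\ll x$. - (O6+): if $a\le b+c$, $x'\ll x\le a,b$ and $y'\ll y\le a,c$, then there are $e,f\in S$ with $a\le e+f$, $x'\ll e\le a,b$ and $y'\ll f\le a,c$. - $S$ is *countably based* if there is a countable $B\subseteq S$ such that every element of $S$ is the supremum of an increasing sequence in $B$. - An *ideal* is a downward hereditary submonoid closed under suprema of increasing sequences. $S$ is *simple* if its only ideals are $\{0\}$ and $S$; $u\in S$ is *full* if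 the only ideal containing $u$ is $S$, and *compact* if $u\ll u$. - $S$ is *stably finite* if, whenever $a\ll\tilde a$ for some $\tilde a\in S$, we have $a\ne a+b$ for all $b\ne0$. - $F(S)$ is the cone of functionals on $S$, that is, of maps $S\to[0,\infty]$ preserving $0$, addition, order and suprema of increasing sequences. It carries the topology in which a net $(\lambda_j)_j$ converges to $\lambda$ if and only if $\limsup_j\lambda_j(a')\le\lambda(a)\le\liminf_j\lambda_j(a)$ whenever $a'\ll a$. For $u\in S$ set $F_{u\mapsto1}(S)=\{\lambda\in F(S):\lambda(u)=1\}$, a convex set. - For a convex set $K\subseteq F(S)$, $\partial_eK$ is its set of extreme points, and $\mathrm{LAff}(K)$ is the set of lower semicontinuous affine functions $K\to(-\infty,\infty]$ with the pointwise order. For $a\in S$, $\widehat a_{|K}\in\mathrm{LAff}(K)$ is given by $\widehat a_{|K}(\lambda)=\lambda(a)$. - $S$ satisfies *Edwards' condition for $\partial_eK$* if $\min\{\lambda(a),\lambda(b)\}=\sup\{\lambda(c):c\in S,\ c\le a,\ c\le b\}$ for all $\lambda\in\partial_eK$ and all $a,b\in S$. **Theorem.** Let $S$ be a countably based, simple,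 stably finite $\mathrm{Cu}$-semigroup satisfying (O5) and (O6+), let $u\in S$ be a compact, full element, and set $K=F_{u\mapsto1}(S)$. Assume that $S$ satisfies Edwards' condition for $\partial_eK$. Then for all $a,b\in S$ there exists $c\in S$ with $c\le a$ and $c\le b$ such that $\widehat c_{|K}$ is the infimum $\widehat a_{|K}\wedge\widehat b_{|K}$ of $\widehat a_{|K}$ and $\widehat b_{|K}$ in the partially ordered set $\mathrm{LAff}(K)$. -/

import Mathlib

open Filter Topology
open scoped ENNReal NNReal

/-! ### Abstract Cuntz semigroups -/

/-- The (sequential) way-below relation `a ≪ b` in a partially ordered set. -/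
def WayBelow {S : Type*} [PartialOrder S] (a b : S) : Prop :=
  ∀ (c : ℕ → S) (s : S), Monotone c → IsLUB (Set.range c) s → b ≤ s → ∃ n, a ≤ c n

/-- Abstract Cuntz semigroups (`Cu`-semigroups): positively ordered commutative monoids
satisfying the axioms (O1)-(O4). -/
structure IsCuSemigroup (S : Type*) [AddCommMonoid S] [PartialOrder S] : Prop where
  /-- the order is translation invariant -/
  add_mono : ∀ a b c : S, a ≤ b → a + c ≤ b + c
  /-- the order is positive -/
  zero_le : ∀ a : S, 0 ≤ a
  /-- (O1): increasing sequences have suprema -/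
  o1 : ∀ f : ℕ → S, Monotone f → ∃ s, IsLUB (Set.range f) s
  /-- (O2): every element is the supremum of a `≪`-increasing sequence -/
  o2 : ∀ a : S, ∃ f : ℕ → S, (∀ n, WayBelow (f n) (f (n + 1))) ∧ IsLUB (Set.range f) a
  /-- (O3): addition preserves `≪` -/
  o3 : ∀ a' a b' b : S, WayBelow a' a → WayBelow b' b → WayBelow (a' + b') (a + b)
  /-- (O4): addition preserves suprema of increasing sequences -/
  o4 : ∀ (f g : ℕ → S) (s t : S), Monotone f → Monotone g →
    IsLUB (Set.range f) s → IsLUB (Set.range g) t →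
    IsLUB (Set.range fun n => f n + g n) (s + t)

/-- Axiom (O5), 'almost algebraic order'. -/
def SatisfiesO5 (S : Type*) [AddCommMonoid S] [PartialOrder S] : Prop :=
  ∀ a' a b' b c : S, a + b ≤ c → WayBelow a' a → WayBelow b' b →
    ∃ x, a' + x ≤ c ∧ c ≤ a + x ∧ WayBelow b' x

/-- Axiom (O6+), 'strengthened almost Riesz decomposition'. -/
def SatisfiesO6Plus (S : Type*) [AddCommMonoid S] [PartialOrder S] : Prop :=
  ∀ a b c x' x y' y : S, a ≤ b + c →
    WayBelow x' x → x ≤ a → x ≤ b → WayBelow y' y → y ≤ a → y ≤ c →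
    ∃ e f, a ≤ e + f ∧ (WayBelow x' e ∧ e ≤ a ∧ e ≤ b) ∧ (WayBelow y' f ∧ f ≤ a ∧ f ≤ c)

/-- Countably based: there is a countable set such that every element is the supremum of an
increasing sequence in that set. -/
def IsCountablyBased (S : Type*) [PartialOrder S] : Prop :=
  ∃ B : Set S, B.Countable ∧
    ∀ a : S, ∃ f : ℕ → S, Monotone f ∧ (∀ n, f n ∈ B) ∧ IsLUB (Set.range f) a

/-- Ideals: downward hereditary submonoids closed under suprema of increasing sequences. -/
def IsCuIdeal {S : Type*} [AddCommMonoid S] [PartialOrder S] (J : AddSubmonoid S) : Prop :=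
  (∀ (f : ℕ → S) (s : S), Monotone f → (∀ n, f n ∈ J) → IsLUB (Set.range f) s → s ∈ J) ∧
  ∀ a b : S, a ≤ b → b ∈ J → a ∈ J

/-- Simple: the only ideals are `{0}` and `S`. -/
def IsSimpleCu (S : Type*) [AddCommMonoid S] [PartialOrder S] : Prop :=
  ∀ J : AddSubmonoid S, IsCuIdeal J → J = ⊥ ∨ J = ⊤

/-- An element is full if it is contained in no proper ideal. -/
def IsFullElement {S : Type*} [AddCommMonoid S] [PartialOrder S] (u : S) : Prop :=
  ∀ J : AddSubmonoid S, IsCuIdeal J → u ∈ J → J = ⊤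

/-- An element is compact if it is way-below itself. -/
def IsCompactCu {S : Type*} [PartialOrder S] (u : S) : Prop := WayBelow u u

/-- `a` is finite if `a ≠ a + b` for every `b ≠ 0`. -/
def IsFiniteCu {S : Type*} [AddCommMonoid S] (a : S) : Prop :=
  ∀ b : S, b ≠ 0 → a ≠ a + b

/-- Stably finite: every element that is way-below some element is finite. -/
def IsStablyFinite (S : Type*) [AddCommMonoid S] [PartialOrder S] : Prop :=
  ∀ a b : S, WayBelow a b → IsFiniteCu a

/-! ### Functionals -/

/-- Functionals on `S`: maps `S → [0,∞]` preserving zero, addition, order, and suprema of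
increasing sequences. -/
structure CuFunctional (S : Type*) [AddCommMonoid S] [PartialOrder S] where
  toFun : S → ℝ≥0∞
  map_zero' : toFun 0 = 0
  map_add' : ∀ a b, toFun (a + b) = toFun a + toFun b
  monotone' : Monotone toFun
  map_sup' : ∀ (f : ℕ → S) (s : S), Monotone f → IsLUB (Set.range f) s →
    toFun s = ⨆ n, toFun (f n)

namespace CuFunctional

variable {S : Type*} [AddCommMonoid S] [PartialOrder S]

instance : FunLike (CuFunctional S) S ℝ≥0∞ where
  coe := toFun
  coe_injective φ ψ h := by cases φ; cases ψ; congr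

@[ext] theorem ext {φ ψ : CuFunctional S} (h : ∀ a, φ a = ψ a) : φ = ψ := DFunLike.ext _ _ h

/-- The zero functional. -/
instance : Zero (CuFunctional S) where
  zero :=
    { toFun := fun _ => 0
      map_zero' := rfl
      map_add' := by simp
      monotone' := fun _ _ _ => le_rfl
      map_sup' := by simp }

/-- Pointwise addition. -/
instance : Add (CuFunctional S) where
  add φ ψ :=
    { toFun := fun a => φ a + ψ a
      map_zero' := by
        change φ.toFun 0 + ψ.toFun 0 = 0
        rw [φ.map_zero', ψ.map_zero', add_zero]
      map_add' := fun a b => by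
        change φ.toFun (a + b) + ψ.toFun (a + b) =
          φ.toFun a + ψ.toFun a + (φ.toFun b + ψ.toFun b)
        rw [φ.map_add', ψ.map_add', add_add_add_comm]
      monotone' := fun _ _ h => add_le_add (φ.monotone' h) (ψ.monotone' h)
      map_sup' := fun f s hf hs => by
        change φ.toFun s + ψ.toFun s = ⨆ n, (φ.toFun (f n) + ψ.toFun (f n))
        rw [φ.map_sup' f s hf hs, ψ.map_sup' f s hf hs]
        exact ENNReal.iSup_add_iSup_of_monotone
          (fun _ _ h => φ.monotone' (hf h)) (fun _ _ h => ψ.monotone' (hf h)) }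

/-- Pointwise scalar multiplication. -/
noncomputable instance : SMul ℝ≥0 (CuFunctional S) where
  smul r φ :=
    { toFun := fun a => (r : ℝ≥0∞) * φ a
      map_zero' := by
        change (r : ℝ≥0∞) * φ.toFun 0 = 0
        rw [φ.map_zero', mul_zero]
      map_add' := fun a b => by
        change (r : ℝ≥0∞) * φ.toFun (a + b) = r * φ.toFun a + r * φ.toFun b
        rw [φ.map_add', mul_add]
      monotone' := fun _ _ h => mul_le_mul_right (φ.monotone' h) _
      map_sup' := fun f s hf hs => by
        change (r : ℝ≥0∞) * φ.toFun s = ⨆ n, (r : ℝ≥0∞) * φ.toFun (f n)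
        rw [φ.map_sup' f s hf hs, ENNReal.mul_iSup] }

theorem zero_apply (a : S) : (0 : CuFunctional S) a = 0 := rfl

theorem add_apply (φ ψ : CuFunctional S) (a : S) : (φ + ψ) a = φ a + ψ a := rfl

theorem smul_apply (r : ℝ≥0) (φ : CuFunctional S) (a : S) : (r • φ) a = r * φ a := rfl

instance : AddCommMonoid (CuFunctional S) where
  add_assoc _ _ _ := ext fun _ => add_assoc _ _ _
  zero_add _ := ext fun _ => zero_add _
  add_zero _ := ext fun _ => add_zero _
  add_comm _ _ := ext fun _ => add_comm _ _
  nsmul := nsmulRec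

/-- The canonical topology on the cone of functionals. By `tendsto_nhds_iff` below,
`φ_j → φ` if and only if `limsup φ_j(a') ≤ φ(a) ≤ liminf φ_j(a)` whenever `a' ≪ a`. -/
instance : TopologicalSpace (CuFunctional S) :=
  TopologicalSpace.generateFrom
    ({U | ∃ (a : S) (r : ℝ≥0∞), U = {φ : CuFunctional S | r < φ a}} ∪
      {U | ∃ (a' : S) (r : ℝ≥0∞),
        U = {φ : CuFunctional S | ∃ a, WayBelow a' a ∧ φ a < r}})

theorem tendsto_nhds_iff (hS : IsCuSemigroup S) {ι : Type*} {l : Filter ι}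
    {f : ι → CuFunctional S} {φ : CuFunctional S} :
    Tendsto f l (𝓝 φ) ↔ ∀ a' a : S, WayBelow a' a →
      limsup (fun j => f j a') l ≤ φ a ∧ φ a ≤ liminf (fun j => f j a) l := by
  have le_of {a b : S} (h : WayBelow a b) : a ≤ b := by
    obtain ⟨n, hn⟩ := h (fun _ => b) b monotone_const (by simp) le_rfl
    exact hn
  rw [TopologicalSpace.tendsto_nhds_generateFrom_iff]
  constructor
  · intro h a' a ha
    refine ⟨le_of_forall_gt_imp_ge_of_dense fun r hr => ?_, ?_⟩
    · refine limsup_le_of_le (h := ?_)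
      filter_upwards [h _ (Or.inr ⟨a', r, rfl⟩) ⟨a, ha, hr⟩] with j hj
      obtain ⟨b, hb, hbr⟩ := hj
      exact ((f j).monotone' (le_of hb)).trans hbr.le
    · refine le_of_forall_lt_imp_le_of_dense fun r hr => ?_
      refine le_liminf_of_le (h := ?_)
      filter_upwards [h _ (Or.inl ⟨a, r, rfl⟩) hr] with j hj
      exact le_of_lt hj
  · rintro h U (⟨a, r, rfl⟩ | ⟨a', r, rfl⟩) hU
    · have h0 : WayBelow 0 a := fun c s _ _ _ => ⟨0, hS.zero_le _⟩
      exact eventually_lt_of_lt_liminf (lt_of_lt_of_le hU (h 0 a h0).2)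
    · obtain ⟨a, ha, har⟩ := hU
      obtain ⟨g, hg, hga⟩ := hS.o2 a
      have hm : Monotone g := monotone_nat_of_le_succ fun n => le_of (hg n)
      obtain ⟨n, hn⟩ := ha g a hm hga le_rfl
      have h1 : WayBelow a' (g (n + 1)) := fun c s hc hs hb =>
        (hg n c s hc hs hb).imp fun _ h => hn.trans h
      have h2 : WayBelow (g (n + 1)) a := fun c s hc hs hb =>
        hg (n + 1) c s hc hs ((hga.1 ⟨n + 2, rfl⟩).trans hb)
      filter_upwards [eventually_lt_of_limsup_lt (lt_of_le_of_lt (h _ _ h2).1 har)] with j hj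
      exact ⟨_, h1, hj⟩

end CuFunctional

/-- `F_{u ↦ 1}(S)`: the functionals normalized at `u`. -/
def normalizedFunctionals {S : Type*} [AddCommMonoid S] [PartialOrder S] (u : S) :
    Set (CuFunctional S) :=
  {φ | φ u = 1}

/-! ### Lower semicontinuous affine functions and ranks -/

/-- `LAff(K)`: the lower semicontinuous, affine functions `K → (-∞,∞]`, for a convex set `K` in a
topological cone, with the pointwise order (inherited from `K → EReal`). -/
def LAff {E : Type*} [TopologicalSpace E] [AddCommMonoid E] [SMul ℝ≥0 E] (K : Set E) : Type _ :=
  {f : K → EReal // (∀ x, f x ≠ ⊥) ∧ LowerSemicontinuous f ∧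
    ∀ (x y z : K) (s t : ℝ≥0), 0 < s → 0 < t → s + t = 1 → (z : E) = s • (x : E) + t • (y : E) →
      f z = ((s : ℝ) : EReal) * f x + ((t : ℝ) : EReal) * f y}

noncomputable instance {E : Type*} [TopologicalSpace E] [AddCommMonoid E] [SMul ℝ≥0 E]
    (K : Set E) : PartialOrder (LAff K) :=
  PartialOrder.lift Subtype.val Subtype.val_injective

/-- The restriction to `K` of the rank `φ ↦ φ(a)` of an element `a`, as an element of `LAff(K)`. -/
noncomputable def rankOn {S : Type*} [AddCommMonoid S] [PartialOrder S]
    (K : Set (CuFunctional S)) (a : S) : LAff K :=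
  ⟨fun φ => (((φ : CuFunctional S) a : ℝ≥0∞) : EReal), by
    refine ⟨fun φ => EReal.coe_ennreal_ne_bot _, ?_, ?_⟩
    · have h : LowerSemicontinuous fun φ : K => (φ : CuFunctional S) a := by
        rw [lowerSemicontinuous_iff_isOpen_preimage]
        intro r
        have hU : IsOpen {φ : CuFunctional S | r < φ a} :=
          TopologicalSpace.isOpen_generateFrom_of_mem (Or.inl ⟨a, r, rfl⟩)
        exact hU.preimage continuous_subtype_val
      exact continuous_coe_ennreal_ereal.comp_lowerSemicontinuous h
        fun _ _ h => EReal.coe_ennreal_le_coe_ennreal_iff.2 h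
    · intro x y z s t _ _ _ hz
      simp only [hz, CuFunctional.add_apply, CuFunctional.smul_apply, EReal.coe_ennreal_add,
        EReal.coe_ennreal_mul]
      rfl⟩

/-- Edwards' condition for a set `X` of functionals: for every `φ ∈ X` and all `a, b`, the minimum
of `φ(a)` and `φ(b)` is the supremum of `φ(c)` over all `c ≤ a, b`. -/
def EdwardsCondition {S : Type*} [AddCommMonoid S] [PartialOrder S]
    (X : Set (CuFunctional S)) : Prop :=
  ∀ φ ∈ X, ∀ a b : S, min (φ a) (φ b) = sSup {r : ℝ≥0∞ | ∃ c, c ≤ a ∧ c ≤ b ∧ r = φ c}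

/-! The element `c` is a common lower bound of `a` and `b` of largest rank on K. Given any lower
bound `f` in `LAff(K)` and an extreme point φ, Edwards' condition writes min(φ(a), φ(b)) as the
supremum of φ(x) over common lower bounds x, so f(φ) ≤ φ(c). The inequality then has to spread from
the extreme points to all of K.

Existence of `c` (`exists_le_le_rank_max`): (O5) and (O6+) make the common lower bounds directed
with respect to rank, up to ≪. Compactness of K turns this into uniform approximate domination, and
a countable base allows an increasing sequence of lower bounds to absorb all of them in rank; `c` is
its supremum.

Passage to K (`LAff.le_of_le_on_extremePoints`): K is compact, and averaging ranks along ≪-chains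
yields enough continuous affine functions to embed it affinely in a product of lines. Hahn–Banach
then approximates lower semicontinuous affine functions from below by continuous affine ones, to
which Bauer's minimum principle applies. -/

/-! ### The way-below relation and full elements. -/

section WayBelow

variable {S : Type*} [PartialOrder S] {a b c : S}

theorem WayBelow.le (h : WayBelow a b) : a ≤ b := by
  obtain ⟨_, hn⟩ := h (fun _ => b) b monotone_const (by simp) le_rfl
  exact hn

theorem WayBelow.trans_le (h : WayBelow a b) (h' : b ≤ c) : WayBelow a c :=
  fun f s hf hs hcs => h f s hf hs (h'.trans hcs)

theorem LE.le.trans_wayBelow (h : a ≤ b) (h' : WayBelow b c) : WayBelow a c :=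
  fun f s hf hs hcs => (h' f s hf hs hcs).imp fun _ hn => h.trans hn

theorem WayBelow.trans (h : WayBelow a b) (h' : WayBelow b c) : WayBelow a c :=
  h.trans_le h'.le

end WayBelow

namespace IsCuSemigroup

variable {S : Type*} [AddCommMonoid S] [PartialOrder S]

theorem zero_wayBelow (hS : IsCuSemigroup S) (a : S) : WayBelow 0 a :=
  fun _ _ _ _ _ => ⟨0, hS.zero_le _⟩

theorem add_le_add (hS : IsCuSemigroup S) {a b c d : S} (h : a ≤ b) (h' : c ≤ d) :
    a + c ≤ b + d :=
  (hS.add_mono _ _ c h).trans <| by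
    rw [add_comm b c, add_comm b d]
    exact hS.add_mono _ _ b h'

/-- Every element is the supremum of a rapidly increasing sequence way-below it. -/
theorem exists_seq (hS : IsCuSemigroup S) (a : S) :
    ∃ f : ℕ → S, Monotone f ∧ (∀ n, WayBelow (f n) (f (n + 1))) ∧ (∀ n, WayBelow (f n) a) ∧
      IsLUB (Set.range f) a := by
  obtain ⟨f, hf, hfa⟩ := hS.o2 a
  exact ⟨f, monotone_nat_of_le_succ fun n => (hf n).le, hf,
    fun n => (hf n).trans_le (hfa.1 ⟨n + 1, rfl⟩), hfa⟩

theorem exists_wayBelow_between (hS : IsCuSemigroup S) {a b : S} (h : WayBelow a b) :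
    ∃ c, WayBelow a c ∧ WayBelow c b := by
  obtain ⟨f, hm, hf, hfb, hlub⟩ := hS.exists_seq b
  obtain ⟨n, hn⟩ := h f b hm hlub le_rfl
  exact ⟨f (n + 1), hn.trans_wayBelow (hf n), hfb _⟩

theorem wayBelow_of_isLUB (hS : IsCuSemigroup S) {x s : S} {f : ℕ → S} (hf : Monotone f)
    (hs : IsLUB (Set.range f) s) (hx : WayBelow x s) : ∃ n, WayBelow x (f n) := by
  obtain ⟨y, hxy, hys⟩ := hS.exists_wayBelow_between hx
  obtain ⟨n, hn⟩ := hys f s hf hs le_rfl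
  exact ⟨n, hxy.trans_le hn⟩

/-- By (O4), sums of approximants of `a` and `b` have supremum `a + b`, so one of them already
dominates `c`. -/
theorem exists_le_add_of_wayBelow_add (hS : IsCuSemigroup S) {a b c : S}
    (h : WayBelow c (a + b)) : ∃ a' b', WayBelow a' a ∧ WayBelow b' b ∧ c ≤ a' + b' := by
  obtain ⟨f, hf, -, hfa, hfl⟩ := hS.exists_seq a
  obtain ⟨g, hg, -, hgb, hgl⟩ := hS.exists_seq b
  obtain ⟨n, hn⟩ := h _ _ (fun i j hij => hS.add_le_add (hf hij) (hg hij))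
    (hS.o4 f g a b hf hg hfl hgl) le_rfl
  exact ⟨_, _, hfa n, hgb n, hn⟩

/-- Every element way-below some element is dominated by a multiple of a given full element. -/
theorem exists_le_nsmul (hS : IsCuSemigroup S) {u : S} (hfull : IsFullElement u) {x y : S}
    (h : WayBelow x y) : ∃ n : ℕ, x ≤ n • u := by
  -- The elements satisfying the conclusion form an ideal containing `u`, so fullness makes it all
  -- of `S`.
  let J : AddSubmonoid S :=
    { carrier := {y | ∀ x, WayBelow x y → ∃ n : ℕ, x ≤ n • u}
      zero_mem' := fun x hx => ⟨0, by simpa using hx.le⟩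
      add_mem' := by
        intro a b ha hb x hx
        obtain ⟨a', b', ha', hb', hle⟩ := hS.exists_le_add_of_wayBelow_add hx
        obtain ⟨m, hm⟩ := ha _ ha'
        obtain ⟨n, hn⟩ := hb _ hb'
        exact ⟨m + n, hle.trans (by rw [add_nsmul]; exact hS.add_le_add hm hn)⟩ }
  have hJ : IsCuIdeal J := by
    refine ⟨fun f s hf hfJ hs x hx => ?_, fun a b hab hb x hx => hb x (hx.trans_le hab)⟩
    obtain ⟨n, hn⟩ := hS.wayBelow_of_isLUB hf hs hx
    exact hfJ n x hn
  have huJ : u ∈ J := fun x hx => ⟨1, by simpa using hx.le⟩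
  have hy : y ∈ J := by
    rw [hfull J hJ huJ]
    trivial
  exact hy x h

end IsCuSemigroup

/-! ### Functionals and their regularization. -/

namespace CuFunctional

variable {S : Type*} [AddCommMonoid S] [PartialOrder S]

theorem map_zero (φ : CuFunctional S) : φ 0 = 0 := φ.map_zero'

theorem map_add (φ : CuFunctional S) (a b : S) : φ (a + b) = φ a + φ b := φ.map_add' a b

theorem mono (φ : CuFunctional S) {a b : S} (h : a ≤ b) : φ a ≤ φ b := φ.monotone' h

theorem map_isLUB (φ : CuFunctional S) {f : ℕ → S} {s : S} (hf : Monotone f)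
    (hs : IsLUB (Set.range f) s) : φ s = ⨆ n, φ (f n) := φ.map_sup' f s hf hs

theorem map_nsmul (φ : CuFunctional S) (n : ℕ) (a : S) : φ (n • a) = n * φ a := by
  induction n with
  | zero => simp [φ.map_zero]
  | succ n ih => rw [succ_nsmul, φ.map_add, ih]; push_cast; ring

theorem isOpen_lt_apply (a : S) (r : ℝ≥0∞) : IsOpen {φ : CuFunctional S | r < φ a} :=
  TopologicalSpace.isOpen_generateFrom_of_mem (Or.inl ⟨a, r, rfl⟩)

theorem isOpen_exists_apply_lt (a : S) (r : ℝ≥0∞) :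
    IsOpen {φ : CuFunctional S | ∃ b, WayBelow a b ∧ φ b < r} :=
  TopologicalSpace.isOpen_generateFrom_of_mem (Or.inr ⟨a, r, rfl⟩)

/-- The regularization of an additive monotone map into a functional. -/
noncomputable def regularize (hS : IsCuSemigroup S) (v : S → ℝ≥0∞) (h0 : v 0 = 0)
    (hadd : ∀ a b, v (a + b) = v a + v b) (hmono : Monotone v) : CuFunctional S where
  toFun a := ⨆ x : {x // WayBelow x a}, v x
  map_zero' := by
    simp only [ENNReal.iSup_eq_zero]
    rintro ⟨x, hx⟩
    exact le_antisymm ((hmono hx.le).trans h0.le) bot_le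
  map_add' a b := by
    have ne (a : S) : Nonempty {x // WayBelow x a} := ⟨⟨0, hS.zero_wayBelow a⟩⟩
    have := ne a
    have := ne b
    apply le_antisymm
    · refine iSup_le fun ⟨x, hx⟩ => ?_
      obtain ⟨a', b', ha', hb', hle⟩ := hS.exists_le_add_of_wayBelow_add hx
      exact ((hmono hle).trans (hadd _ _).le).trans
        (add_le_add (le_iSup (fun x : {x // WayBelow x a} => v x) ⟨a', ha'⟩)
          (le_iSup (fun x : {x // WayBelow x b} => v x) ⟨b', hb'⟩))
    · refine ENNReal.iSup_add_iSup_le fun ⟨x, hx⟩ ⟨y, hy⟩ => ?_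
      rw [← hadd]
      exact le_iSup (fun x : {x // WayBelow x (a + b)} => v x) ⟨x + y, hS.o3 _ _ _ _ hx hy⟩
  monotone' a b hab := iSup_le fun ⟨x, hx⟩ =>
    le_iSup (fun x : {x // WayBelow x b} => v x) ⟨x, hx.trans_le hab⟩
  map_sup' f s hf hs := by
    apply le_antisymm
    · refine iSup_le fun ⟨x, hx⟩ => ?_
      obtain ⟨n, hn⟩ := hS.wayBelow_of_isLUB hf hs hx
      exact (le_iSup (fun x : {x // WayBelow x (f n)} => v x) ⟨x, hn⟩).trans
        (le_iSup (fun n => ⨆ x : {x // WayBelow x (f n)}, v x) n)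
    · refine iSup_le fun n => iSup_le fun ⟨x, hx⟩ => ?_
      exact le_iSup (fun x : {x // WayBelow x s} => v x) ⟨x, hx.trans_le (hs.1 ⟨n, rfl⟩)⟩

theorem regularize_apply (hS : IsCuSemigroup S) (v : S → ℝ≥0∞) (h0 : v 0 = 0)
    (hadd : ∀ a b, v (a + b) = v a + v b) (hmono : Monotone v) (a : S) :
    regularize hS v h0 hadd hmono a = ⨆ x : {x // WayBelow x a}, v x := rfl

end CuFunctional

/-! ### Compactness of the normalized functionals. -/

section Normalized

variable {S : Type*} [AddCommMonoid S] [PartialOrder S]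

/-- The pointwise limit of an ultrafilter is additive and monotone but may fail to preserve suprema.
Its regularization does preserve them, and is still a limit because the topology compares values
only across ≪. Compactness of `u` keeps the value at `u` equal to 1. -/
theorem isCompact_normalizedFunctionals (hS : IsCuSemigroup S) {u : S} (hu : IsCompactCu u) :
    IsCompact (normalizedFunctionals u) := by
  rw [isCompact_iff_ultrafilter_le_nhds]
  intro U hU
  let v : S → ℝ≥0∞ := fun a => (U.map fun φ : CuFunctional S => φ a).lim
  have hv (a : S) : Tendsto (fun φ : CuFunctional S => φ a) U (𝓝 (v a)) :=
    (U.map fun φ : CuFunctional S => φ a).le_nhds_lim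
  have h0 : v 0 = 0 := by
    refine tendsto_nhds_unique (hv 0) ?_
    simp only [CuFunctional.map_zero]
    exact tendsto_const_nhds
  have hadd (a b : S) : v (a + b) = v a + v b := by
    refine tendsto_nhds_unique (hv (a + b)) ?_
    simp only [CuFunctional.map_add]
    exact (hv a).add (hv b)
  have hmono : Monotone v := fun a b hab =>
    le_of_tendsto_of_tendsto' (hv a) (hv b) fun φ => φ.mono hab
  refine ⟨CuFunctional.regularize hS v h0 hadd hmono, ?_, ?_⟩
  · have hvu : v u = 1 := by
      refine tendsto_nhds_unique (hv u) (tendsto_const_nhds.congr' ?_)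
      filter_upwards [le_principal_iff.1 hU] with φ hφ
      exact (show φ u = 1 from hφ).symm
    change CuFunctional.regularize hS v h0 hadd hmono u = 1
    rw [CuFunctional.regularize_apply, ← hvu]
    exact le_antisymm (iSup_le fun x => hmono x.2.le)
      (le_iSup (fun x : {x // WayBelow x u} => v x) ⟨u, hu⟩)
  · change Tendsto id (U : Filter (CuFunctional S)) _
    rw [TopologicalSpace.tendsto_nhds_generateFrom_iff]
    rintro W (⟨a, r, rfl⟩ | ⟨a', r, rfl⟩) hW
    · obtain ⟨⟨x, hx⟩, hrx⟩ := lt_iSup_iff.1 (show r < ⨆ x : {x // WayBelow x a}, v x from hW)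
      filter_upwards [(hv x).eventually (lt_mem_nhds hrx)] with φ hφ
      exact lt_of_lt_of_le hφ (φ.mono hx.le)
    · obtain ⟨x, hx, hxr⟩ := hW
      obtain ⟨y, hay, hyx⟩ := hS.exists_wayBelow_between hx
      have hyr : v y < r :=
        (le_iSup (fun z : {z // WayBelow z x} => v z) ⟨y, hyx⟩).trans_lt hxr
      filter_upwards [(hv y).eventually (gt_mem_nhds hyr)] with φ hφ
      exact ⟨y, hay, hφ⟩

theorem smul_add_smul_mem_normalizedFunctionals {u : S} {φ ψ : CuFunctional S}
    (hφ : φ ∈ normalizedFunctionals u) (hψ : ψ ∈ normalizedFunctionals u) {s t : ℝ≥0}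
    (hst : s + t = 1) : s • φ + t • ψ ∈ normalizedFunctionals u := by
  have h1 : φ u = 1 := hφ
  have h2 : ψ u = 1 := hψ
  change (s • φ + t • ψ) u = 1
  rw [CuFunctional.add_apply, CuFunctional.smul_apply, CuFunctional.smul_apply, h1, h2, mul_one, mul_one]
  exact_mod_cast hst

/-- Normalized functionals are finite, with a uniform bound, below multiples of the unit. -/
theorem apply_le_of_le_nsmul {u a : S} {n : ℕ} (h : a ≤ n • u) {φ : CuFunctional S}
    (hφ : φ ∈ normalizedFunctionals u) : φ a ≤ n := by
  have h1 : φ u = 1 := hφ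
  simpa [φ.map_nsmul, h1] using φ.mono h

end Normalized

/-! ### Riemann sums along ≪-chains. -/

section DyadicMean

variable {S : Type*}

/-- The mean of `w` over the `2 ^ n` consecutive pairs obtained from `(a, b)` by repeated
insertion of midpoints `m`. -/
noncomputable def dyadicMean (m : S → S → S) (w : S → S → ℝ) : ℕ → S → S → ℝ
  | 0, a, b => w a b
  | n + 1, a, b => (dyadicMean m w n a (m a b) + dyadicMean m w n (m a b) b) / 2

variable (m : S → S → S)

/-- Right-endpoint and left-endpoint sums over a chain differ by a telescoping sum. The gap depends
only on the end values of `l`, which later makes the error uniform over functionals. -/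
theorem dyadicMean_upper_eq (l : S → ℝ) (n : ℕ) (a b : S) :
    dyadicMean m (fun _ y => l y) n a b =
      dyadicMean m (fun x _ => l x) n a b + (l b - l a) / 2 ^ n := by
  induction n generalizing a b with
  | zero => simp [dyadicMean]
  | succ n ih =>
    simp only [dyadicMean, ih]
    rw [pow_succ]
    field_simp
    ring

variable [PartialOrder S] {m}
  (hm : ∀ a b, WayBelow a b → WayBelow a (m a b) ∧ WayBelow (m a b) b) {d : S}

include hm

theorem dyadicMean_linear {w w₁ w₂ : S → S → ℝ} {s t : ℝ}
    (h : ∀ x y, WayBelow x y → y ≤ d → w x y = s * w₁ x y + t * w₂ x y) (n : ℕ) {a b : S}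
    (hab : WayBelow a b) (hbd : b ≤ d) :
    dyadicMean m w n a b = s * dyadicMean m w₁ n a b + t * dyadicMean m w₂ n a b := by
  induction n generalizing a b with
  | zero => exact h a b hab hbd
  | succ n ih =>
    obtain ⟨h1, h2⟩ := hm a b hab
    simp only [dyadicMean, ih h1 (h2.le.trans hbd), ih h2 hbd]
    ring

theorem eventually_lt_dyadicMean_add {X : Type*} {F : Filter X} {w : X → S → S → ℝ}
    {w' : S → S → ℝ} {ε : ℝ}
    (h : ∀ a b, WayBelow a b → b ≤ d → ∀ᶠ x in F, w x a b < w' a b + ε) (n : ℕ) {a b : S}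
    (hab : WayBelow a b) (hbd : b ≤ d) :
    ∀ᶠ x in F, dyadicMean m (w x) n a b < dyadicMean m w' n a b + ε := by
  induction n generalizing a b with
  | zero => exact h a b hab hbd
  | succ n ih =>
    obtain ⟨h1, h2⟩ := hm a b hab
    filter_upwards [ih h1 (h2.le.trans hbd), ih h2 hbd] with x hx hx'
    simp only [dyadicMean]
    linarith

theorem eventually_dyadicMean_sub_lt {X : Type*} {F : Filter X} {w : X → S → S → ℝ}
    {w' : S → S → ℝ} {ε : ℝ}
    (h : ∀ a b, WayBelow a b → b ≤ d → ∀ᶠ x in F, w' a b - ε < w x a b) (n : ℕ) {a b : S}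
    (hab : WayBelow a b) (hbd : b ≤ d) :
    ∀ᶠ x in F, dyadicMean m w' n a b - ε < dyadicMean m (w x) n a b := by
  induction n generalizing a b with
  | zero => exact h a b hab hbd
  | succ n ih =>
    obtain ⟨h1, h2⟩ := hm a b hab
    filter_upwards [ih h1 (h2.le.trans hbd), ih h2 hbd] with x hx hx'
    simp only [dyadicMean]
    linarith

variable {l : S → ℝ} (hl : ∀ x y, x ≤ y → y ≤ d → l x ≤ l y)

include hl

theorem dyadicMean_lower_le (n : ℕ) {a b : S} (hab : WayBelow a b) (hbd : b ≤ d) :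
    dyadicMean m (fun x _ => l x) n a b ≤ l b := by
  induction n generalizing a b with
  | zero => exact hl _ _ hab.le hbd
  | succ n ih =>
    obtain ⟨h1, h2⟩ := hm a b hab
    have := ih h1 (h2.le.trans hbd)
    have := ih h2 hbd
    have := hl _ _ h2.le hbd
    simp only [dyadicMean]
    linarith

theorem dyadicMean_lower_le_succ (n : ℕ) {a b : S} (hab : WayBelow a b) (hbd : b ≤ d) :
    dyadicMean m (fun x _ => l x) n a b ≤ dyadicMean m (fun x _ => l x) (n + 1) a b := by
  induction n generalizing a b with
  | zero =>
    obtain ⟨h1, h2⟩ := hm a b hab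
    have := hl _ _ h1.le (h2.le.trans hbd)
    simp only [dyadicMean]
    linarith
  | succ n ih =>
    obtain ⟨h1, h2⟩ := hm a b hab
    have h3 := ih h1 (h2.le.trans hbd)
    have h4 := ih h2 hbd
    rw [dyadicMean, dyadicMean]
    linarith

omit hm hl in
/-- The limit of the lower dyadic means: an average of `l` over a path from `a` to `b`. -/
noncomputable def pathMean (m : S → S → S) (l : S → ℝ) (a b : S) : ℝ :=
  ⨆ n, dyadicMean m (fun x _ => l x) n a b

theorem bddAbove_dyadicMean_lower {a b : S} (hab : WayBelow a b) (hbd : b ≤ d) :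
    BddAbove (Set.range fun n => dyadicMean m (fun x _ => l x) n a b) :=
  ⟨l b, by rintro _ ⟨n, rfl⟩; exact dyadicMean_lower_le hm hl n hab hbd⟩

theorem dyadicMean_lower_le_pathMean (n : ℕ) {a b : S} (hab : WayBelow a b) (hbd : b ≤ d) :
    dyadicMean m (fun x _ => l x) n a b ≤ pathMean m l a b :=
  le_ciSup (bddAbove_dyadicMean_lower hm hl hab hbd) n

theorem le_pathMean {a b : S} (hab : WayBelow a b) (hbd : b ≤ d) : l a ≤ pathMean m l a b :=
  dyadicMean_lower_le_pathMean hm hl 0 hab hbd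

theorem pathMean_le {a b : S} (hab : WayBelow a b) (hbd : b ≤ d) : pathMean m l a b ≤ l b :=
  ciSup_le fun n => dyadicMean_lower_le hm hl n hab hbd

theorem tendsto_dyadicMean_lower {a b : S} (hab : WayBelow a b) (hbd : b ≤ d) :
    Tendsto (fun n => dyadicMean m (fun x _ => l x) n a b) atTop (𝓝 (pathMean m l a b)) :=
  tendsto_atTop_ciSup
    (monotone_nat_of_le_succ fun n => dyadicMean_lower_le_succ hm hl n hab hbd)
    (bddAbove_dyadicMean_lower hm hl hab hbd)

theorem tendsto_dyadicMean_upper {a b : S} (hab : WayBelow a b) (hbd : b ≤ d) :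
    Tendsto (fun n => dyadicMean m (fun _ y => l y) n a b) atTop (𝓝 (pathMean m l a b)) := by
  simp only [dyadicMean_upper_eq]
  have h : Tendsto (fun n : ℕ => (l b - l a) / 2 ^ n) atTop (𝓝 0) :=
    tendsto_const_nhds.div_atTop (tendsto_pow_atTop_atTop_of_one_lt one_lt_two)
  simpa using (tendsto_dyadicMean_lower hm hl hab hbd).add h

theorem dyadicMean_upper_succ_le (n : ℕ) {a b : S} (hab : WayBelow a b) (hbd : b ≤ d) :
    dyadicMean m (fun _ y => l y) (n + 1) a b ≤ dyadicMean m (fun _ y => l y) n a b := by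
  induction n generalizing a b with
  | zero =>
    obtain ⟨h1, h2⟩ := hm a b hab
    have := hl _ _ h2.le hbd
    simp only [dyadicMean]
    linarith
  | succ n ih =>
    obtain ⟨h1, h2⟩ := hm a b hab
    have h3 := ih h1 (h2.le.trans hbd)
    have h4 := ih h2 hbd
    have e (k : ℕ) : dyadicMean m (fun _ y => l y) (k + 1) a b =
      (dyadicMean m (fun _ y => l y) k a (m a b) +
        dyadicMean m (fun _ y => l y) k (m a b) b) / 2 := rfl
    rw [e (n + 1), e n]
    linarith

theorem pathMean_le_dyadicMean_upper (n : ℕ) {a b : S} (hab : WayBelow a b) (hbd : b ≤ d) :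
    pathMean m l a b ≤ dyadicMean m (fun _ y => l y) n a b :=
  (antitone_nat_of_succ_le fun n => dyadicMean_upper_succ_le hm hl n hab hbd).le_of_tendsto
    (tendsto_dyadicMean_upper hm hl hab hbd) n

end DyadicMean

/-! ### Continuous affine coordinates on the normalized functionals. -/

section Normalized

variable {S : Type*} [AddCommMonoid S] [PartialOrder S] {m : S → S → S}
  (hm : ∀ a b, WayBelow a b → WayBelow a (m a b) ∧ WayBelow (m a b) b) {u : S} {N : ℕ}

theorem apply_ne_top_of_le_nsmul {a : S} (h : a ≤ N • u) {φ : CuFunctional S}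
    (hφ : φ ∈ normalizedFunctionals u) : φ a ≠ ⊤ :=
  ne_top_of_le_ne_top (ENNReal.natCast_ne_top N) (apply_le_of_le_nsmul h hφ)

theorem toReal_apply_le_toReal_apply {φ : CuFunctional S} (hφ : φ ∈ normalizedFunctionals u)
    (x y : S) (hxy : x ≤ y) (hy : y ≤ N • u) : (φ x).toReal ≤ (φ y).toReal :=
  ENNReal.toReal_mono (apply_ne_top_of_le_nsmul hy hφ) (φ.mono hxy)

include hm

/-- A single rank is only lower semicontinuous, but for x ≪ y and ψ near φ one has ψ(x) < φ(y) + ε.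
Left-endpoint sums thus bound the mean from below, while right-endpoint sums at φ control nearby
left-endpoint sums from above; the two differ by at most `N / 2 ^ n`. -/
theorem continuous_pathMean {a b : S} (hab : WayBelow a b) (hb : b ≤ N • u) :
    Continuous fun φ : normalizedFunctionals u =>
      pathMean m (fun x => ((φ : CuFunctional S) x).toReal) a b := by
  have hl (φ : normalizedFunctionals u) := toReal_apply_le_toReal_apply (N := N) φ.2
  have fin (φ : normalizedFunctionals u) {x : S} (hx : x ≤ N • u) :=
    apply_ne_top_of_le_nsmul hx φ.2
  refine continuous_iff_continuousAt.2 fun φ => tendsto_order.2 ⟨fun r hr => ?_, fun r hr => ?_⟩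
  · obtain ⟨n, hn⟩ :=
      ((tendsto_dyadicMean_lower hm (hl φ) hab hb).eventually (lt_mem_nhds hr)).exists
    have key := eventually_dyadicMean_sub_lt hm (d := N • u) (F := 𝓝 φ)
      (w := fun ψ x _ => ((ψ : CuFunctional S) x).toReal)
      (w' := fun x _ => ((φ : CuFunctional S) x).toReal)
      (ε := dyadicMean m (fun x _ => ((φ : CuFunctional S) x).toReal) n a b - r) (fun x y hxy hy => by
        set ε := dyadicMean m (fun x _ => ((φ : CuFunctional S) x).toReal) n a b - r
        have hε : 0 < ε := sub_pos.2 hn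
        -- `ENNReal.ofReal` truncates at 0, so a negative bound, which holds trivially, is treated
        -- separately.
        rcases lt_or_ge (((φ : CuFunctional S) x).toReal - ε) 0 with h0 | h0
        · exact Eventually.of_forall fun ψ => h0.trans_le ENNReal.toReal_nonneg
        · have hx := hxy.le.trans hy
          have hlt : ENNReal.ofReal (((φ : CuFunctional S) x).toReal - ε) <
              (φ : CuFunctional S) x := by
            rw [ENNReal.ofReal_lt_iff_lt_toReal h0 (fin φ hx)]
            linarith
          filter_upwards [((CuFunctional.isOpen_lt_apply x _).preimage
            continuous_subtype_val).mem_nhds hlt] with ψ hψ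
          exact (ENNReal.ofReal_lt_iff_lt_toReal h0 (fin ψ hx)).1 hψ) n hab hb
    filter_upwards [key] with ψ hψ
    have := dyadicMean_lower_le_pathMean hm (hl ψ) n hab hb
    linarith
  · set H := pathMean m (fun x => ((φ : CuFunctional S) x).toReal) a b
    have h2 : Tendsto (fun n : ℕ => (N : ℝ) / 2 ^ n) atTop (𝓝 0) :=
      tendsto_const_nhds.div_atTop (tendsto_pow_atTop_atTop_of_one_lt one_lt_two)
    -- Half of the gap `r - H` pays for the Riemann sum at φ and the uniform error `N / 2 ^ n`; the
    -- other half is the ε below.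
    obtain ⟨n, hn⟩ := (((tendsto_dyadicMean_upper hm (hl φ) hab hb).add h2).eventually
      (gt_mem_nhds (show H + 0 < (H + r) / 2 by linarith))).exists
    have key := eventually_lt_dyadicMean_add hm (d := N • u) (F := 𝓝 φ)
      (w := fun ψ x _ => ((ψ : CuFunctional S) x).toReal)
      (w' := fun _ y => ((φ : CuFunctional S) y).toReal)
      (ε := (r - H) / 2) (fun x y hxy hy => by
        have hε : 0 < (r - H) / 2 := by linarith
        have hlt : (φ : CuFunctional S) y <
            ENNReal.ofReal (((φ : CuFunctional S) y).toReal + (r - H) / 2) := by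
          rw [ENNReal.lt_ofReal_iff_toReal_lt (fin φ hy)]
          linarith
        filter_upwards [((CuFunctional.isOpen_exists_apply_lt x _).preimage
          continuous_subtype_val).mem_nhds ⟨y, hxy, hlt⟩] with ψ hψ
        obtain ⟨z, hz, hzr⟩ := hψ
        exact (ENNReal.lt_ofReal_iff_toReal_lt (fin ψ (hxy.le.trans hy))).1
          ((CuFunctional.mono _ hz.le).trans_lt hzr)) n hab hb
    filter_upwards [key] with ψ hψ
    have h3 := pathMean_le_dyadicMean_upper hm (hl ψ) n hab hb
    rw [dyadicMean_upper_eq] at h3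
    have h4 : ((ψ : CuFunctional S) b).toReal ≤ N :=
      ENNReal.toReal_le_of_le_ofReal (Nat.cast_nonneg N)
        (by simpa using apply_le_of_le_nsmul hb ψ.2)
    have h5 : (((ψ : CuFunctional S) b).toReal - ((ψ : CuFunctional S) a).toReal) / 2 ^ n ≤
        (N : ℝ) / 2 ^ n := by
      gcongr
      linarith [ENNReal.toReal_nonneg (a := (ψ : CuFunctional S) a)]
    linarith

theorem pathMean_affine {φ ψ χ : normalizedFunctionals u} {s t : ℝ≥0}
    (h : (χ : CuFunctional S) = s • (φ : CuFunctional S) + t • (ψ : CuFunctional S))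
    {a b : S} (hab : WayBelow a b) (hb : b ≤ N • u) :
    pathMean m (fun x => ((χ : CuFunctional S) x).toReal) a b =
      s * pathMean m (fun x => ((φ : CuFunctional S) x).toReal) a b +
        t * pathMean m (fun x => ((ψ : CuFunctional S) x).toReal) a b := by
  have hl (φ : normalizedFunctionals u) := toReal_apply_le_toReal_apply (N := N) φ.2
  refine tendsto_nhds_unique (tendsto_dyadicMean_lower hm (hl χ) hab hb) ?_
  refine (((tendsto_dyadicMean_lower hm (hl φ) hab hb).const_mul (s : ℝ)).add
    ((tendsto_dyadicMean_lower hm (hl ψ) hab hb).const_mul (t : ℝ))).congr fun n => ?_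
  refine (dyadicMean_linear hm (d := N • u) (fun x y hxy hy => ?_) n hab hb).symm
  have hx := hxy.le.trans hy
  rw [h, CuFunctional.add_apply, CuFunctional.smul_apply, CuFunctional.smul_apply,
    ENNReal.toReal_add (ENNReal.mul_ne_top ENNReal.coe_ne_top (apply_ne_top_of_le_nsmul hx φ.2))
      (ENNReal.mul_ne_top ENNReal.coe_ne_top (apply_ne_top_of_le_nsmul hx ψ.2)),
    ENNReal.toReal_mul, ENNReal.toReal_mul, ENNReal.coe_toReal, ENNReal.coe_toReal]

end Normalized

/-- The normalized functionals embed, continuously and affinely, into a product of lines. -/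
theorem exists_continuous_injective_affine {S : Type*} [AddCommMonoid S] [PartialOrder S]
    (hS : IsCuSemigroup S) {u : S} (hfull : IsFullElement u) :
    ∃ Φ : normalizedFunctionals u → ((S × S) → ℝ), Continuous Φ ∧ Function.Injective Φ ∧
      ∀ (x y z : normalizedFunctionals u) (s t : ℝ≥0),
        (z : CuFunctional S) = s • (x : CuFunctional S) + t • (y : CuFunctional S) →
          Φ z = (s : ℝ) • Φ x + (t : ℝ) • Φ y := by
  classical
  have hm' : ∀ p : S × S, ∃ c, WayBelow p.1 p.2 → WayBelow p.1 c ∧ WayBelow c p.2 := fun p => by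
    by_cases h : WayBelow p.1 p.2
    · obtain ⟨c, hc⟩ := hS.exists_wayBelow_between h
      exact ⟨c, fun _ => hc⟩
    · exact ⟨p.1, fun h' => absurd h' h⟩
  choose μ hμ using hm'
  let m : S → S → S := fun a b => μ (a, b)
  have hm : ∀ a b, WayBelow a b → WayBelow a (m a b) ∧ WayBelow (m a b) b :=
    fun a b h => hμ (a, b) h
  let P : S × S → Prop := fun p => WayBelow p.1 p.2 ∧ ∃ N : ℕ, p.2 ≤ N • u
  -- One coordinate per pair a ≪ b with b below a multiple of `u`, where all values are finite;
  -- other coordinates are 0.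
  let Φ : normalizedFunctionals u → ((S × S) → ℝ) := fun φ p =>
    if P p then pathMean m (fun x => ((φ : CuFunctional S) x).toReal) p.1 p.2 else 0
  refine ⟨Φ, continuous_pi fun p => ?_, ?_, fun x y z s t h => funext fun p => ?_⟩
  · by_cases hp : P p
    · simp only [Φ, if_pos hp]
      exact continuous_pathMean hm hp.1 hp.2.choose_spec
    · simp only [Φ, if_neg hp]
      exact continuous_const
  · have key (φ ψ : normalizedFunctionals u) (h : Φ φ = Φ ψ) (a : S) :
        (φ : CuFunctional S) a ≤ (ψ : CuFunctional S) a := by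
      obtain ⟨f, hf, hf1, hf2, hfa⟩ := hS.exists_seq a
      rw [CuFunctional.map_isLUB _ hf hfa]
      refine iSup_le fun n => le_trans ?_ (CuFunctional.mono _ (hf2 (n + 1)).le)
      obtain ⟨N, hN⟩ := hS.exists_le_nsmul hfull (hf2 (n + 1))
      have hp : P (f n, f (n + 1)) := ⟨hf1 n, N, hN⟩
      have e := congrFun h (f n, f (n + 1))
      simp only [Φ, if_pos hp] at e
      -- The common mean lies between φ(f n) and ψ(f (n+1)); taking suprema over n gives φ(a) ≤
      -- ψ(a).
      have h1 := le_pathMean hm (toReal_apply_le_toReal_apply φ.2) (hf1 n) hN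
      have h2 := pathMean_le hm (toReal_apply_le_toReal_apply ψ.2) (hf1 n) hN
      exact (ENNReal.toReal_le_toReal (apply_ne_top_of_le_nsmul ((hf1 n).le.trans hN) φ.2)
        (apply_ne_top_of_le_nsmul hN ψ.2)).1 (by linarith)
    exact fun φ ψ h => Subtype.ext <| CuFunctional.ext fun a =>
      le_antisymm (key φ ψ h a) (key ψ φ h.symm a)
  · simp only [Φ, Pi.add_apply, Pi.smul_apply, smul_eq_mul]
    by_cases hp : P p
    · simp only [if_pos hp]
      exact pathMean_affine hm h hp.1 hp.2.choose_spec
    · simp only [if_neg hp]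
      ring

/-! ### Lower semicontinuous affine functions on compact convex sets. -/

namespace LAff

variable {F : Type*} [TopologicalSpace F] [AddCommMonoid F] [SMul ℝ≥0 F] {K : Set F}

theorem ne_bot (f : LAff K) (x : K) : f.1 x ≠ ⊥ := f.2.1 x

theorem lowerSemicontinuous (f : LAff K) : LowerSemicontinuous f.1 := f.2.2.1

theorem map_affine (f : LAff K) {x y z : K} {s t : ℝ≥0} (hs : 0 < s) (ht : 0 < t)
    (hst : s + t = 1) (h : (z : F) = s • (x : F) + t • (y : F)) :
    f.1 z = ((s : ℝ) : EReal) * f.1 x + ((t : ℝ) : EReal) * f.1 y :=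
  f.2.2.2 x y z s t hs ht hst h

variable {E : Type*} [AddCommGroup E] [Module ℝ E] [TopologicalSpace E]
  [IsTopologicalAddGroup E] [ContinuousSMul ℝ E] [LocallyConvexSpace ℝ E] [T2Space E]
  {Φ : K → E}

/-- A lower semicontinuous affine function on a compact convex set is, at each point,
approximated from below by continuous affine functions. -/
theorem exists_affine_lt (hK : IsCompact K)
    (hconv : ∀ x ∈ K, ∀ y ∈ K, ∀ s t : ℝ≥0, s + t = 1 → s • x + t • y ∈ K)
    (hΦ : Continuous Φ) (hinj : Function.Injective Φ)
    (haff : ∀ (x y z : K) (s t : ℝ≥0), (z : F) = s • (x : F) + t • (y : F) →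
      Φ z = (s : ℝ) • Φ x + (t : ℝ) • Φ y)
    (f : LAff K) (x₀ : K) {r : ℝ} (hr : (r : EReal) < f.1 x₀) :
    ∃ (ℓ : E →L[ℝ] ℝ) (k : ℝ), (∀ x, ((ℓ (Φ x) + k : ℝ) : EReal) ≤ f.1 x) ∧
      r < ℓ (Φ x₀) + k := by
  have : CompactSpace K := isCompact_iff_compactSpace.1 hK
  by_cases htop : ∀ x, f.1 x = ⊤
  · exact ⟨0, r + 1, fun x => by simp [htop x], by simp⟩
  push Not at htop
  obtain ⟨x₁, hx₁⟩ := htop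
  -- The epigraph of `f`, transported by Φ, is closed and convex; a hyperplane separating (Φ x₀, r)
  -- from it yields the affine minorant.
  let C : Set (E × ℝ) := {p | ∃ x, p.1 = Φ x ∧ f.1 x ≤ (p.2 : EReal)}
  have hCmem (x : K) (t : ℝ) (h : f.1 x ≤ (t : EReal)) : (Φ x, t) ∈ C := ⟨x, rfl, h⟩
  have hclosed : IsClosed C := by
    have h1 : IsClosed {p : K × ℝ | f.1 p.1 ≤ (p.2 : EReal)} :=
      f.lowerSemicontinuous.isClosed_epigraph.preimage
        (f := fun p : K × ℝ => (p.1, (p.2 : EReal)))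
        (continuous_fst.prodMk (continuous_coe_real_ereal.comp continuous_snd))
    have h2 : IsClosedEmbedding (Prod.map Φ (id : ℝ → ℝ)) :=
      (hΦ.isClosedEmbedding hinj).prodMap IsClosedEmbedding.id
    have h3 := h2.isClosedMap _ h1
    convert h3 using 1
    ext ⟨e, t⟩
    constructor
    · rintro ⟨x, hx, hxt⟩
      exact ⟨(x, t), hxt, by simp [← hx]⟩
    · rintro ⟨⟨x, t'⟩, hxt, h⟩
      obtain ⟨h1, h2⟩ := Prod.mk.inj h
      exact ⟨x, h1.symm, by simpa [← h2] using hxt⟩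
  have hconvex : Convex ℝ C := by
    rw [convex_iff_forall_pos]
    rintro ⟨e₁, t₁⟩ ⟨x, hx, hxt⟩ ⟨e₂, t₂⟩ ⟨y, hy, hyt⟩ s t hs ht hst
    lift s to ℝ≥0 using hs.le
    lift t to ℝ≥0 using ht.le
    have hs' : 0 < s := by exact_mod_cast hs
    have ht' : 0 < t := by exact_mod_cast ht
    have hst' : s + t = 1 := by exact_mod_cast hst
    let z : K := ⟨s • (x : F) + t • (y : F), hconv _ x.2 _ y.2 s t hst'⟩
    refine ⟨z, ?_, ?_⟩
    · rw [haff x y z s t rfl]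
      dsimp at hx hy ⊢
      rw [hx, hy]
    · rw [f.map_affine hs' ht' hst' (z := z) rfl]
      dsimp at hxt hyt ⊢
      gcongr
  have hnot : (Φ x₀, r) ∉ C := by
    rintro ⟨x, hx, hxr⟩
    obtain rfl : x₀ = x := hinj hx
    exact absurd hr (not_lt.2 hxr)
  obtain ⟨L, w, hLw, hL⟩ := geometric_hahn_banach_point_closed hconvex hclosed hnot
  let ℓ : E →L[ℝ] ℝ := L.comp (ContinuousLinearMap.inl ℝ E ℝ)
  let c : ℝ := L (0, 1)
  have hLe (e : E) (t : ℝ) : L (e, t) = ℓ e + t * c := by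
    have : (e, t) = (e, (0 : ℝ)) + t • ((0 : E), (1 : ℝ)) := by simp
    rw [this, map_add, map_smul]
    rfl
  rw [hLe] at hLw
  have hfin (x : K) (hx : f.1 x ≠ ⊤) : ∃ t : ℝ, f.1 x = t :=
    ⟨(f.1 x).toReal, (EReal.coe_toReal hx (f.ne_bot x)).symm⟩
  have hc : 0 ≤ c := by
    by_contra! hc
    obtain ⟨t, ht⟩ := hfin x₁ hx₁
    -- A negative `c` would let the functional drop to `w` or lower high up in the epigraph over
    -- `x₁`.
    let t' := max t ((w - ℓ (Φ x₁)) / c)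
    have h1 := hL _ (hCmem x₁ t' (by rw [ht]; exact_mod_cast le_max_left _ _))
    rw [hLe] at h1
    have h2 : (w - ℓ (Φ x₁)) / c ≤ t' := le_max_right _ _
    rw [div_le_iff_of_neg hc] at h2
    linarith
  rcases hc.eq_or_lt with hc | hc
  · -- the separating hyperplane is vertical
    obtain ⟨y, -, hy⟩ := LowerSemicontinuousOn.exists_isMinOn (s := Set.univ) ⟨x₁, trivial⟩
      isCompact_univ (f.lowerSemicontinuous.lowerSemicontinuousOn _)
    have hy' (x : K) : f.1 y ≤ f.1 x := hy (Set.mem_univ x)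
    obtain ⟨q, hq⟩ := hfin y (ne_top_of_le_ne_top hx₁ (hy' x₁))
    rw [← hc, mul_zero, add_zero] at hLw
    have hpos : 0 < w - ℓ (Φ x₀) := sub_pos.2 hLw
    obtain ⟨N, hN⟩ := exists_nat_gt ((r - q) / (w - ℓ (Φ x₀)))
    rw [div_lt_iff₀ hpos] at hN
    -- The function `w - ℓ` is negative wherever `f` is finite and positive at `x₀`, so a large
    -- multiple of it can be added to the minimum `q` of `f`.
    refine ⟨-((N : ℝ) • ℓ), q + N * w, fun x => ?_, ?_⟩
    · by_cases hx : f.1 x = ⊤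
      · simp [hx]
      · obtain ⟨t, ht⟩ := hfin x hx
        have h1 := hL _ (hCmem x t ht.le)
        rw [hLe, ← hc, mul_zero, add_zero] at h1
        have h2 := hy' x
        rw [hq, ht, EReal.coe_le_coe_iff] at h2
        rw [ht, EReal.coe_le_coe_iff]
        have : (N : ℝ) * w ≤ N * ℓ (Φ x) := by gcongr
        simp only [neg_apply, smul_apply, smul_eq_mul]
        linarith
    · simp only [neg_apply, smul_apply, smul_eq_mul]
      linarith
  · refine ⟨-(c⁻¹ • ℓ), c⁻¹ * w, fun x => ?_, ?_⟩
    · by_cases hx : f.1 x = ⊤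
      · simp [hx]
      · obtain ⟨t, ht⟩ := hfin x hx
        have h1 := hL _ (hCmem x t ht.le)
        rw [hLe] at h1
        rw [ht, EReal.coe_le_coe_iff]
        have : c⁻¹ * w ≤ c⁻¹ * (ℓ (Φ x) + t * c) := by gcongr
        have e : c⁻¹ * (t * c) = t := by field_simp
        simp only [neg_apply, smul_apply, smul_eq_mul]
        linarith
    · have : c⁻¹ * (ℓ (Φ x₀) + r * c) < c⁻¹ * w := by gcongr
      have e : c⁻¹ * (r * c) = r := by field_simp
      simp only [neg_apply, smul_apply, smul_eq_mul]
      linarith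

/-- Bauer's minimum principle: a lower semicontinuous affine function dominating a continuous
affine function on the extreme points dominates it everywhere. -/
theorem affine_le_of_le_on_extremePoints (hK : IsCompact K)
    (hΦ : Continuous Φ) (hinj : Function.Injective Φ)
    (haff : ∀ (x y z : K) (s t : ℝ≥0), (z : F) = s • (x : F) + t • (y : F) →
      Φ z = (s : ℝ) • Φ x + (t : ℝ) • Φ y)
    (g : LAff K) (ℓ : E →L[ℝ] ℝ) (k : ℝ)
    (h : ∀ x : K, (x : F) ∈ K.extremePoints ℝ≥0 → ((ℓ (Φ x) + k : ℝ) : EReal) ≤ g.1 x) (x : K) :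
    ((ℓ (Φ x) + k : ℝ) : EReal) ≤ g.1 x := by
  have : CompactSpace K := isCompact_iff_compactSpace.1 hK
  by_contra! hx
  let G : K → EReal := fun y => g.1 y + ((-(ℓ (Φ y) + k) : ℝ) : EReal)
  have hGreal {y : K} {q : ℝ} (hq : g.1 y = q) : G y = ((q - (ℓ (Φ y) + k) : ℝ) : EReal) := by
    simp only [G, hq, ← EReal.coe_add, sub_eq_add_neg]
  have hGtop {y : K} (hq : g.1 y = ⊤) : G y = ⊤ := by
    simp only [G, hq, EReal.top_add_coe]
  have hfin (x : K) (hx : g.1 x ≠ ⊤) : ∃ t : ℝ, g.1 x = t :=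
    ⟨(g.1 x).toReal, (EReal.coe_toReal hx (g.ne_bot x)).symm⟩
  have hGlsc : LowerSemicontinuous G := by
    refine g.lowerSemicontinuous.add' (Continuous.lowerSemicontinuous ?_) fun y =>
      EReal.continuousAt_add (Or.inr (EReal.coe_ne_bot _)) (Or.inr (EReal.coe_ne_top _))
    exact continuous_coe_real_ereal.comp ((ℓ.continuous.comp hΦ).add continuous_const).neg
  obtain ⟨y, -, hy⟩ := LowerSemicontinuousOn.exists_isMinOn (s := Set.univ) ⟨x, trivial⟩
    isCompact_univ (hGlsc.lowerSemicontinuousOn _)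
  have hy' (z : K) : G y ≤ G z := hy (Set.mem_univ z)
  obtain ⟨p, hp⟩ := hfin x (ne_top_of_lt hx)
  have hGx : G x < 0 := by
    rw [hp, EReal.coe_lt_coe_iff] at hx
    rw [hGreal hp]
    exact_mod_cast sub_neg.2 hx
  have hytop : g.1 y ≠ ⊤ := fun h => by
    have := (hy' x).trans_lt hGx
    rw [hGtop h] at this
    exact absurd this (not_lt.2 le_top)
  obtain ⟨q, hq⟩ := hfin y hytop
  set c := q - (ℓ (Φ y) + k) with hc
  have hGy : G y = c := hGreal hq
  have hc0 : c < 0 := by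
    have := (hy' x).trans_lt hGx
    rw [hGy] at this
    exact_mod_cast this
  let M : Set K := {z | G z ≤ c}
  have hM : IsCompact M := (hGlsc.isClosed_preimage _).isCompact
  obtain ⟨e, he⟩ := (hM.image hΦ).extremePoints_nonempty ⟨Φ y, y, hGy.le, rfl⟩
  obtain ⟨z, hz, rfl⟩ := he.1
  have hMreal {v : K} (hv : v ∈ M) : g.1 v = ((c + (ℓ (Φ v) + k) : ℝ) : EReal) := by
    have htop : g.1 v ≠ ⊤ := fun h => by
      have h' : G v ≤ c := hv
      rw [hGtop h] at h'
      exact EReal.coe_ne_top c (top_le_iff.1 h')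
    obtain ⟨t, ht⟩ := hfin v htop
    have h1 : G v = c := le_antisymm hv (hGy ▸ hy' v)
    rw [hGreal ht, EReal.coe_eq_coe_iff] at h1
    rw [ht, EReal.coe_eq_coe_iff]
    linarith
  have hzext : (z : F) ∈ K.extremePoints ℝ≥0 := by
    rw [mem_extremePoints_iff_left]
    refine ⟨z.2, fun v hv w hw hzvw => ?_⟩
    obtain ⟨s, t, hs, ht, hst, hzst⟩ := hzvw
    lift v to K using hv
    lift w to K using hw
    have hg := g.map_affine hs ht hst hzst.symm
    have hΦz := haff v w z s t hzst.symm
    have hstR : (s : ℝ) + t = 1 := by exact_mod_cast hst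
    have hsR : (0 : ℝ) < s := by exact_mod_cast hs
    have htR : (0 : ℝ) < t := by exact_mod_cast ht
    have hbot {p : ℝ} (hp : 0 < p) {y : EReal} (hy : y ≠ ⊥) : (p : EReal) * y ≠ ⊥ := by
      induction y with
      | bot => exact absurd rfl hy
      | coe y => exact EReal.coe_ne_bot (p * y)
      | top => rw [EReal.coe_mul_top_of_pos hp]; exact top_ne_bot
    have e : (s : ℝ) * (c + k) + t * (c + k) = c + k := by rw [← add_mul, hstR, one_mul]
    have hvtop : g.1 v ≠ ⊤ := fun h => by
      rw [h, hMreal hz, EReal.coe_mul_top_of_pos hsR,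
        EReal.top_add_of_ne_bot (hbot htR (g.ne_bot w))] at hg
      exact EReal.coe_ne_top _ hg
    have hwtop : g.1 w ≠ ⊤ := fun h => by
      rw [h, hMreal hz, EReal.coe_mul_top_of_pos htR,
        EReal.add_top_of_ne_bot (hbot hsR (g.ne_bot v))] at hg
      exact EReal.coe_ne_top _ hg
    obtain ⟨v', hv'⟩ := hfin v hvtop
    obtain ⟨w', hw'⟩ := hfin w hwtop
    have hv1 := hy' v
    have hw1 := hy' w
    rw [hGy, hGreal hv', EReal.coe_le_coe_iff] at hv1
    rw [hGy, hGreal hw', EReal.coe_le_coe_iff] at hw1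
    rw [hMreal hz, hv', hw'] at hg
    norm_cast at hg
    rw [hΦz, map_add, map_smul, map_smul, smul_eq_mul, smul_eq_mul] at hg
    -- A convex combination of two values at least `c` that equals `c`, with positive weights,
    -- forces both to be `c`.
    have hvM : v ∈ M := by
      change G v ≤ c
      rw [hGreal hv', EReal.coe_le_coe_iff]
      by_contra! hlt
      nlinarith [mul_lt_mul_of_pos_left hlt hsR, mul_le_mul_of_nonneg_left hw1 htR.le]
    have hwM : w ∈ M := by
      change G w ≤ c
      rw [hGreal hw', EReal.coe_le_coe_iff]
      by_contra! hlt
      nlinarith [mul_lt_mul_of_pos_left hlt htR, mul_le_mul_of_nonneg_left hv1 hsR.le]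
    exact congrArg _ (hinj ((mem_extremePoints_iff_left.1 he).2 _ ⟨v, hvM, rfl⟩ _ ⟨w, hwM, rfl⟩
      ⟨s, t, hsR, htR, hstR, hΦz.symm⟩))
  have h1 := h z hzext
  rw [hMreal hz, EReal.coe_le_coe_iff] at h1
  linarith

/-- The order of lower semicontinuous affine functions is determined on the extreme points. -/
theorem le_of_le_on_extremePoints (hK : IsCompact K)
    (hconv : ∀ x ∈ K, ∀ y ∈ K, ∀ s t : ℝ≥0, s + t = 1 → s • x + t • y ∈ K)
    (hΦ : Continuous Φ) (hinj : Function.Injective Φ)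
    (haff : ∀ (x y z : K) (s t : ℝ≥0), (z : F) = s • (x : F) + t • (y : F) →
      Φ z = (s : ℝ) • Φ x + (t : ℝ) • Φ y)
    (f g : LAff K) (h : ∀ x : K, (x : F) ∈ K.extremePoints ℝ≥0 → f.1 x ≤ g.1 x) : f ≤ g := by
  change f.1 ≤ g.1
  intro x
  by_contra! hx
  obtain ⟨r, hgr, hrf⟩ := EReal.lt_iff_exists_real_btwn.1 hx
  obtain ⟨ℓ, k, hℓ, hr⟩ := exists_affine_lt hK hconv hΦ hinj haff f x hrf
  have h1 := affine_le_of_le_on_extremePoints hK hΦ hinj haff g ℓ k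
    (fun y hy => (hℓ y).trans (h y hy)) x
  have h2 : (r : EReal) < ((ℓ (Φ x) + k : ℝ) : EReal) := EReal.coe_lt_coe_iff.2 hr
  exact absurd (hgr.trans h2) (not_lt.2 h1)

end LAff

/-! ### A common lower bound of largest rank. -/

section Infimum

variable {S : Type*} [AddCommMonoid S] [PartialOrder S] {u : S}

/-- The set of lower bounds of two elements is upward directed with respect to ranks. -/
theorem exists_wayBelow_le_le_rank_le (hS : IsCuSemigroup S) (hO5 : SatisfiesO5 S)
    (hO6 : SatisfiesO6Plus S) (hfull : IsFullElement u) {a b c c' d d' : S}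
    (hc' : WayBelow c' c) (hca : c ≤ a) (hcb : c ≤ b)
    (hd' : WayBelow d' d) (hda : d ≤ a) (hdb : d ≤ b) :
    ∃ e, WayBelow d' e ∧ e ≤ a ∧ e ≤ b ∧ ∀ φ ∈ normalizedFunctionals u, φ c' ≤ φ e := by
  obtain ⟨c'', hcc, hc''⟩ := hS.exists_wayBelow_between hc'
  obtain ⟨d'', hdd, hd''⟩ := hS.exists_wayBelow_between hd'
  obtain ⟨f, hf, -, hfa, hlub⟩ := hS.exists_seq a
  obtain ⟨i, hi⟩ := hc'' f a hf hlub hca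
  obtain ⟨j, hj⟩ := hd'' f a hf hlub hda
  obtain ⟨A, hAa, hcA, hdA⟩ : ∃ A, WayBelow A a ∧ c'' ≤ A ∧ d'' ≤ A :=
    ⟨f (max i j), hfa _, hi.trans (hf (le_max_left _ _)), hj.trans (hf (le_max_right _ _))⟩
  obtain ⟨N, hN⟩ := hS.exists_le_nsmul hfull hAa
  -- Here `y` is an almost complement: c' + y ≤ A ≤ c'' + y ≤ b + y. Decomposing A by (O6+) gives c'
  -- + y ≤ A ≤ e + y in rank. Since A lies below a multiple of `u`, φ(y) is finite and cancels.
  obtain ⟨y, hy, hAy, -⟩ := hO5 c' c'' 0 0 A (by simpa using hcA) hcc (hS.zero_wayBelow 0)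
  obtain ⟨e, f, hef, ⟨he, heA, heb⟩, -, -, hfy⟩ := hO6 A b y d' d'' 0 0
    (hAy.trans (hS.add_mono _ _ y (hc''.le.trans hcb))) hdd hdA (hd''.le.trans hdb)
    (hS.zero_wayBelow 0) (hS.zero_le _) (hS.zero_le _)
  refine ⟨e, he, heA.trans hAa.le, heb, fun φ hφ => ?_⟩
  have hyA : y ≤ A := le_trans (by simpa using hS.add_mono _ _ y (hS.zero_le c')) hy
  have hfin : φ y ≠ ⊤ := apply_ne_top_of_le_nsmul (hyA.trans hN) hφ
  have h1 : φ c' + φ y ≤ φ e + φ y := by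
    rw [← φ.map_add, ← φ.map_add]
    exact φ.mono (hy.trans (hef.trans (hS.add_le_add le_rfl hfy)))
  exact (ENNReal.add_le_add_iff_right hfin).1 h1

/-- A comparison of ranks is approximately attained way below the larger element. -/
theorem exists_rank_le_add (hS : IsCuSemigroup S) (hu : IsCompactCu u) {c c' d e : S} {N : ℕ}
    (hc' : WayBelow c' c) (hcN : c ≤ N • u) (hd : WayBelow d e)
    (hce : ∀ φ ∈ normalizedFunctionals u, φ c ≤ φ e) {ε : ℝ≥0∞} (hε : 0 < ε) :
    ∃ e', WayBelow e' e ∧ d ≤ e' ∧ ∀ φ ∈ normalizedFunctionals u, φ c' ≤ φ e' + ε := by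
  obtain ⟨f, hf, -, hfe, hlub⟩ := hS.exists_seq e
  -- An open version of φ(c') < φ(f n) + ε, with a number r between the two sides and an x ≫ c' in
  -- place of c'. The first set covers φ(c) < ε, where no r < φ(f n) need exist.
  let U : ℕ → Set (CuFunctional S) := fun n =>
    {φ | ∃ x, WayBelow c' x ∧ φ x < ε} ∪
      ⋃ r : ℝ≥0∞, {φ | r < φ (f n)} ∩ {φ | ∃ x, WayBelow c' x ∧ φ x < r + ε}
  have hUopen (n : ℕ) : IsOpen (U n) :=
    (CuFunctional.isOpen_exists_apply_lt _ _).union <| isOpen_iUnion fun r =>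
      (CuFunctional.isOpen_lt_apply _ _).inter (CuFunctional.isOpen_exists_apply_lt _ _)
  have hUmono : Monotone U := fun i j hij => Set.union_subset_union_right _ <|
    Set.iUnion_mono fun r => Set.inter_subset_inter_left _ fun φ hφ =>
      lt_of_lt_of_le hφ (φ.mono (hf hij))
  have hcover : normalizedFunctionals u ⊆ ⋃ n, U n := by
    intro φ hφ
    rw [Set.mem_iUnion]
    rcases lt_or_ge (φ c) ε with h | h
    · exact ⟨0, Or.inl ⟨c, hc', h⟩⟩
    · have hfin := apply_ne_top_of_le_nsmul hcN hφ
      have hpos : φ c ≠ 0 := (hε.trans_le h).ne'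
      have hlt : φ c - ε < φ e := (ENNReal.sub_lt_self hfin hpos hε.ne').trans_le (hce φ hφ)
      obtain ⟨r, hr, hre⟩ := exists_between hlt
      rw [φ.map_isLUB hf hlub] at hre
      obtain ⟨n, hn⟩ := lt_iSup_iff.1 hre
      refine ⟨n, Or.inr (Set.mem_iUnion.2 ⟨r, hn, c, hc', ?_⟩)⟩
      exact (ENNReal.sub_lt_iff_lt_right (ne_top_of_le_ne_top hfin h) h).1 hr
  obtain ⟨n, hn⟩ := (isCompact_normalizedFunctionals hS hu).elim_directed_cover U hUopen hcover
    hUmono.directed_le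
  obtain ⟨k, hk⟩ := hd f e hf hlub le_rfl
  refine ⟨f (max n k), hfe _, hk.trans (hf (le_max_right _ _)), fun φ hφ => ?_⟩
  have hn' : φ (f n) ≤ φ (f (max n k)) := φ.mono (hf (le_max_left _ _))
  rcases hn hφ with ⟨x, hx, hxe⟩ | h
  · exact (φ.mono hx.le).trans (hxe.le.trans le_add_self)
  · obtain ⟨r, hr, x, hx, hxr⟩ := Set.mem_iUnion.1 h
    exact (φ.mono hx.le).trans (hxr.le.trans
      (add_le_add_left ((show r < φ (f n) from hr).le.trans hn') ε))

/-- Two elements have a common lower bound of largest rank. -/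
theorem exists_le_le_rank_max (hS : IsCuSemigroup S) (hbased : IsCountablyBased S)
    (hO5 : SatisfiesO5 S) (hO6 : SatisfiesO6Plus S) (hu : IsCompactCu u)
    (hfull : IsFullElement u) (a b : S) :
    ∃ c, c ≤ a ∧ c ≤ b ∧ ∀ x, x ≤ a → x ≤ b → ∀ φ ∈ normalizedFunctionals u, φ x ≤ φ c := by
  obtain ⟨B, hB, hBsup⟩ := hbased
  -- Each member keeps a common lower bound strictly above it, leaving room for (O6+) to enlarge it.
  let L : Set S := {x | ∃ y, WayBelow x y ∧ y ≤ a ∧ y ≤ b}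
  have h0L : (0 : S) ∈ L := ⟨0, hS.zero_wayBelow 0, hS.zero_le a, hS.zero_le b⟩
  have hD : (insert 0 (B ∩ L)).Countable := (hB.mono Set.inter_subset_left).insert 0
  obtain ⟨q, hq⟩ := hD.exists_eq_range ⟨0, Set.mem_insert _ _⟩
  have hqL (n : ℕ) : q n ∈ L := by
    have : q n ∈ insert 0 (B ∩ L) := hq ▸ Set.mem_range_self n
    rcases this with h | h
    · rwa [h]
    · exact h.2
  -- Stage n treats the first unpaired component of n, so each `q i` recurs at all stages `Nat.pair
  -- i k`, with errors tending to 0.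
  have step (n : ℕ) (d : L) : ∃ d' : L, (d : S) ≤ d' ∧ ∀ φ ∈ normalizedFunctionals u,
      φ (q n.unpair.1) ≤ φ d' + ((n : ℝ≥0∞) + 1)⁻¹ := by
    obtain ⟨d, y, hdy, hya, hyb⟩ := d
    obtain ⟨c, hc, hca, hcb⟩ := hqL n.unpair.1
    obtain ⟨c', hc1, hc2⟩ := hS.exists_wayBelow_between hc
    obtain ⟨N, hN⟩ := hS.exists_le_nsmul hfull hc2
    obtain ⟨e, hde, hea, heb, hce⟩ :=
      exists_wayBelow_le_le_rank_le hS hO5 hO6 hfull hc2 hca hcb hdy hya hyb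
    obtain ⟨e', hee, hde', he'⟩ := exists_rank_le_add hS hu hc1 hN hde hce
      (ε := ((n : ℝ≥0∞) + 1)⁻¹) (by simp)
    exact ⟨⟨e', e, hee, hea, heb⟩, hde', he'⟩
  choose next hnext1 hnext2 using step
  let d : ℕ → L := fun n => Nat.rec (motive := fun _ => L) ⟨0, h0L⟩ next n
  have hd : Monotone fun n => (d n : S) :=
    monotone_nat_of_le_succ fun n => hnext1 n (d n)
  obtain ⟨c, hc⟩ := hS.o1 _ hd
  refine ⟨c, hc.2 ?_, hc.2 ?_, fun x hxa hxb φ hφ => ?_⟩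
  · rintro _ ⟨n, rfl⟩
    obtain ⟨y, hy, hya, -⟩ := (d n).2
    exact hy.le.trans hya
  · rintro _ ⟨n, rfl⟩
    obtain ⟨y, hy, -, hyb⟩ := (d n).2
    exact hy.le.trans hyb
  · have hqc (i : ℕ) : φ (q i) ≤ φ c := by
      have h1 (k : ℕ) : φ (q i) ≤ φ c + (k : ℝ≥0∞)⁻¹ := by
        have h2 := hnext2 (Nat.pair i k) (d (Nat.pair i k)) φ hφ
        rw [Nat.unpair_pair] at h2
        refine h2.trans (add_le_add (φ.mono (hc.1 ⟨Nat.pair i k + 1, rfl⟩)) ?_)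
        rw [ENNReal.inv_le_inv]
        exact_mod_cast (Nat.right_le_pair i k).trans (Nat.le_succ _)
      have h3 : Tendsto (fun k : ℕ => φ c + (k : ℝ≥0∞)⁻¹) atTop (𝓝 (φ c + 0)) :=
        tendsto_const_nhds.add ENNReal.tendsto_inv_nat_nhds_zero
      rw [add_zero] at h3
      exact ge_of_tendsto' h3 h1
    obtain ⟨f, hf, hf1, hf2, hlub⟩ := hS.exists_seq x
    rw [φ.map_isLUB hf hlub]
    refine iSup_le fun n => ?_
    -- A base element fits between `f n` and `f (n + 1)`; it lies in `L` and hence is some `q i`.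
    obtain ⟨g, hg, hgB, hglub⟩ := hBsup (f (n + 1))
    obtain ⟨k, hk⟩ := hf1 n g _ hg hglub le_rfl
    have hgL : g k ∈ L := ⟨x, (hglub.1 ⟨k, rfl⟩ : g k ≤ _).trans_wayBelow (hf2 (n + 1)), hxa, hxb⟩
    have hmem : g k ∈ Set.range q := hq ▸ Set.mem_insert_of_mem _ ⟨hgB k, hgL⟩
    obtain ⟨i, hi⟩ := hmem
    exact (φ.mono hk).trans (hi ▸ hqc i)

end Infimum

/-! ### The infimum of two ranks. -/

theorem theorem6p4 {S : Type*} [AddCommMonoid S] [PartialOrder S] (hS : IsCuSemigroup S)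
    (hbased : IsCountablyBased S) (hsimple : IsSimpleCu S) (hfin : IsStablyFinite S)
    (hO5 : SatisfiesO5 S) (hO6 : SatisfiesO6Plus S)
    (u : S) (hu : IsCompactCu u) (hfull : IsFullElement u)
    (hEdw : EdwardsCondition ((normalizedFunctionals u).extremePoints ℝ≥0)) (a b : S) :
    ∃ c : S, c ≤ a ∧ c ≤ b ∧
      IsGLB {rankOn (normalizedFunctionals u) a, rankOn (normalizedFunctionals u) b}
        (rankOn (normalizedFunctionals u) c) := by
  obtain ⟨c, hca, hcb, hmax⟩ := exists_le_le_rank_max hS hbased hO5 hO6 hu hfull a b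
  have hrank {x y : S} (h : x ≤ y) :
      rankOn (normalizedFunctionals u) x ≤ rankOn (normalizedFunctionals u) y := fun φ =>
    EReal.coe_ennreal_le_coe_ennreal_iff.2 (CuFunctional.mono _ h)
  refine ⟨c, hca, hcb, ?_, fun f hf => ?_⟩
  · rintro _ (rfl | rfl)
    · exact hrank hca
    · exact hrank hcb
  · obtain ⟨Φ, hΦ, hinj, haff⟩ := exists_continuous_injective_affine hS hfull
    refine LAff.le_of_le_on_extremePoints (isCompact_normalizedFunctionals hS hu)
      (fun x hx y hy s t hst => smul_add_smul_mem_normalizedFunctionals hx hy hst)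
      hΦ hinj haff f _ fun φ hφ => ?_
    have hfa : f.1 φ ≤ (((φ : CuFunctional S) a : ℝ≥0∞) : EReal) :=
      (hf (Set.mem_insert _ _) : f ≤ _) φ
    have hfb : f.1 φ ≤ (((φ : CuFunctional S) b : ℝ≥0∞) : EReal) :=
      (hf (Set.mem_insert_of_mem _ rfl) : f ≤ _) φ
    -- Edwards' condition enters here, at an extreme point, and the maximality of `c` bounds every
    -- term of the supremum.
    have hmin : min ((φ : CuFunctional S) a) ((φ : CuFunctional S) b) ≤
        (φ : CuFunctional S) c := by
      rw [hEdw _ hφ a b]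
      refine sSup_le ?_
      rintro _ ⟨x, hxa, hxb, rfl⟩
      exact hmax x hxa hxb _ φ.2
    refine le_trans ?_ (EReal.coe_ennreal_le_coe_ennreal_iff.2 hmin)
    rcases min_choice ((φ : CuFunctional S) a) ((φ : CuFunctional S) b) with h | h <;>
      rw [h] <;> assumption
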